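/- All rings are commutative with identity. Let $A \subseteq B$ be an extension of integral domains, let $K$ be the quotient field of $A$ (viewed inside the quotient field of $B$), and let $R = A \propto B$ be the trivial ring extension of $A$ by the $A$-module $B$, i.e. the additive group $A \times B$ with multiplication $(a,b)(a',b') = (aa', ab' + a'b)$. A ring $S$ is called \emph{Gaussian} if $c(fg) = c(f)c(g)$ for all $f, g \in S[x]$, where $c(f)$ denotes the ideal of $S$ generated by the coefficients of $f$; \emph{Prüfer} if every finitely generated ideal of $S$ that contains a non-zero-divisor is invertible (so a domain is Prüfer iff each of its nonzero finitely generated ideals is invertible); and \emph{arithmetical} if every finitely generated ideal of $S$ becomes principal in the localization of $S$ at each maximal ideal. The \emph{weak dimension} of $S$ is the supremum of the flat dimensions of all $S$-modules. Then: 1. $R$ is Gaussian if and only if $R$ is Prüfer, if and only if $A$ is a Prüfer domain with $K \subseteq B$. 2. $R$ is arithmetical if and only if $A$ is a Prüfer domain with $K = B$. 3. The weak dimension of $R$ is infinite (with no further assumption on $A$ and $B$). -/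

import Mathlib

open scoped nonZeroDivisors Polynomial

universe u v

/-- A ring is Gaussian if `c(fg) = c(f) c(g)` for all polynomials `f`, `g`, where `c` is the
ideal generated by the coefficients. -/
def IsGaussianRing (R : Type u) [CommRing R] : Prop :=
  ∀ f g : R[X], (f * g).contentIdeal = f.contentIdeal * g.contentIdeal

/-- A ring is Prüfer if every finitely generated regular ideal (one that contains a
non-zero-divisor) is invertible as a fractional ideal of the total ring of quotients. -/
def IsPruferRing (R : Type u) [CommRing R] : Prop :=
  ∀ I : Ideal R, I.FG → (∃ r ∈ I, r ∈ R⁰) →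
    IsUnit (I : FractionalIdeal R⁰ (FractionRing R))

/-- A domain is Prüfer if every nonzero finitely generated ideal is invertible. -/
def IsPruferDomain (A : Type u) [CommRing A] [IsDomain A] : Prop :=
  ∀ I : Ideal A, I.FG → I ≠ ⊥ → IsUnit (I : FractionalIdeal A⁰ (FractionRing A))

/-- A ring is arithmetical if every finitely generated ideal is locally principal, that is,
becomes principal in the localization at each maximal ideal. -/
def IsArithmeticalRing (R : Type u) [CommRing R] : Prop :=
  ∀ I : Ideal R, I.FG → ∀ (P : Ideal R) [P.IsMaximal],
    (I.map (algebraMap R (Localization.AtPrime P))).IsPrincipal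

/-- `HasFlatDimLE R n M`: there is an exact sequence `0 → Fₙ → ⋯ → F₀ → M → 0` of `R`-modules
with all `Fᵢ` flat. For `n + 1` the sequence is split at `F₀`: the rest of it is a flat
resolution of length `n` of the kernel of `F₀ → M`. -/
def HasFlatDimLE (R : Type u) [CommRing R] :
    ℕ → ∀ (M : Type u) [AddCommGroup M] [Module R M], Prop
  | 0, M, _, _ => Module.Flat R M
  | n + 1, M, _, _ => ∃ (F : Type u) (_ : AddCommGroup F) (_ : Module R F) (f : F →ₗ[R] M),
      Module.Flat R F ∧ Function.Surjective f ∧ HasFlatDimLE R n (LinearMap.ker f)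

/-- The flat dimension of a module: the least length of a flat resolution, `⊤` if there is no
finite one. -/
noncomputable def flatDim (R : Type u) [CommRing R] (M : Type u) [AddCommGroup M] [Module R M] :
    ℕ∞ :=
  ⨅ (n : ℕ) (_ : HasFlatDimLE R n M), (n : ℕ∞)

/-- The weak (global) dimension of a ring: the supremum of the flat dimensions of its modules. -/
noncomputable def weakDim (R : Type u) [CommRing R] : ℕ∞ :=
  ⨆ M : ModuleCat.{u} R, flatDim R M

/-- For an extension of domains `A ⊆ B`, the quotient field `K` of `A` as a subring of the
quotient field of `B`. -/
noncomputable def quotientFieldIn {A : Type u} {B : Type v} [CommRing A] [CommRing B] [IsDomain B]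
    [Algebra A B] (h : Function.Injective (algebraMap A B)) : Subring (FractionRing B) :=
  (IsFractionRing.map (K := FractionRing A) (L := FractionRing B) h).range

/-- A domain `B` as a subring of its quotient field. -/
noncomputable def domainInQuotientField (B : Type v) [CommRing B] [IsDomain B] :
    Subring (FractionRing B) :=
  (algebraMap B (FractionRing B)).range

/-! Write N = 0 × B, an ideal of square zero with R/N = A. An element of R is regular exactly when
its first component is nonzero. If the nonzero elements of A are invertible in B, i.e. K ⊆ B, a
regular element divides all of N (`dvd_of_fst_dvd`), so every regular ideal is extended from A and
inherits invertibility. Conversely, comparing (a, 0) with the square-zero element (0, 1) forces a to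
be invertible in B when R is Gaussian, Prüfer or arithmetical. A Prüfer R is Gaussian because
invertible contents are multiplicative, while two contents inside N have product zero.

Prüfer domains and arithmetical rings both amount to `ComaximalDvd`, which passes to quotients and
so from R to A. Applied to two elements of N it makes every element of B a fraction over A.

For the weak dimension, `TorVanishes` holds for flat modules and passes from the kernel of a
surjection from a flat module to its target, hence holds in finite flat dimension. It fails for R/N:
(0, 1) kills the class of 1, N kills everything, but no nonzero a in A kills that class. -/

/-! ### Invertible ideals -/

/-- An ideal is invertible in the total ring of quotients iff some multiple of it is generated by
a non-zero-divisor. -/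
theorem isUnit_coeIdeal_iff {S : Type u} [CommRing S] (I : Ideal S) :
    IsUnit (I : FractionalIdeal S⁰ (FractionRing S)) ↔
      ∃ J : Ideal S, ∃ t ∈ S⁰, I * J = Ideal.span {t} := by
  constructor
  · rintro ⟨u, hu⟩
    refine ⟨(↑u⁻¹ : FractionalIdeal S⁰ (FractionRing S)).num,
      (↑u⁻¹ : FractionalIdeal S⁰ (FractionRing S)).den, SetLike.coe_mem _, ?_⟩
    apply FractionalIdeal.coeIdeal_injective' (P := FractionRing S) le_rfl
    beta_reduce
    rw [FractionalIdeal.coeIdeal_mul, ← FractionalIdeal.den_mul_self_eq_num', ← hu,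
      FractionalIdeal.coeIdeal_span_singleton, mul_left_comm, Units.mul_inv, mul_one]
  · rintro ⟨J, t, ht, h⟩
    have h' : (I : FractionalIdeal S⁰ (FractionRing S)) * J =
        FractionalIdeal.spanSingleton S⁰ (algebraMap S (FractionRing S) t) := by
      rw [← FractionalIdeal.coeIdeal_mul, h, FractionalIdeal.coeIdeal_span_singleton]
    obtain ⟨w, hw⟩ := (IsLocalization.map_units (FractionRing S) (⟨t, ht⟩ : S⁰)).exists_right_inv
    refine IsUnit.of_mul_eq_one (J * FractionalIdeal.spanSingleton S⁰ w) ?_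
    rw [← mul_assoc, h', FractionalIdeal.spanSingleton_mul_spanSingleton]
    simp only at hw
    rw [hw, FractionalIdeal.spanSingleton_one]

/-! ### Content ideals -/

theorem mem_contentIdeal_of_coeff_eq {S : Type u} [CommRing S] {f : S[X]} {a : S} (n : ℕ)
    (h : f.coeff n = a) : a ∈ f.contentIdeal :=
  h ▸ Polynomial.coeff_mem_contentIdeal f n

/-- Multiplying by a polynomial of unit content does not change the content ideal. -/
theorem contentIdeal_le_contentIdeal_mul {S : Type u} [CommRing S] (f h : S[X])
    (hh : h.contentIdeal = ⊤) : f.contentIdeal ≤ (f * h).contentIdeal := by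
  set I := (f * h).contentIdeal with hI
  set π := Ideal.Quotient.mk I
  have h0 : f.map π * h.map π = 0 := by
    rw [← Polynomial.map_mul, Polynomial.ext_iff]
    intro n
    rw [Polynomial.coeff_map, Polynomial.coeff_zero, Ideal.Quotient.eq_zero_iff_mem]
    exact Polynomial.coeff_mem_contentIdeal _ n
  -- McCoy: a polynomial zero divisor is killed by a nonzero constant, which would then kill the
  -- unit content of h.
  have hreg : h.map π ∈ (S ⧸ I)[X]⁰ := by
    by_contra hn
    obtain ⟨a, ha, hah⟩ := Polynomial.notMem_nonZeroDivisors_iff.1 hn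
    apply ha
    have h1 : (1 : S ⧸ I) ∈ (h.map π).contentIdeal := by
      rw [Polynomial.contentIdeal_map_eq_map_contentIdeal, hh, Ideal.map_top]
      trivial
    have h2 : (h.map π).contentIdeal ≤ LinearMap.ker (LinearMap.mulLeft (S ⧸ I) a) := by
      rw [Polynomial.contentIdeal_def, Ideal.span_le]
      intro c hc
      obtain ⟨n, -, rfl⟩ := Polynomial.mem_coeffs_iff.1 (Finset.mem_coe.1 hc)
      simpa using congrArg (fun p => Polynomial.coeff p n) hah
    simpa using h2 h1
  have hf : f.map π = 0 := (mem_nonZeroDivisors_iff_right.1 hreg) _ h0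
  rw [Polynomial.contentIdeal_def, Ideal.span_le]
  intro c hc
  obtain ⟨n, -, rfl⟩ := Polynomial.mem_coeffs_iff.1 (Finset.mem_coe.1 hc)
  rw [SetLike.mem_coe, ← Ideal.Quotient.eq_zero_iff_mem, ← Polynomial.coeff_map, hf,
    Polynomial.coeff_zero]

/-- If `t ∈ c(g) J`, there is a polynomial `j` with coefficients in `J` such that `t` is a
coefficient of `g * j`. -/
theorem exists_coeff_mul_eq_of_mem_contentIdeal_mul {S : Type u} [CommRing S] (g : S[X])
    (J : Ideal S) {t : S} (ht : t ∈ g.contentIdeal * J) :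
    ∃ j : S[X], j.contentIdeal ≤ J ∧ ∃ n, (g * j).coeff n = t := by
  -- Always aiming at the position `g.natDegree`, reached from position n by a shift of X ^
  -- (natDegree - n), makes solutions for different t additive.
  have key : ∀ t ∈ g.contentIdeal * J, ∃ j : S[X], (∀ n, j.coeff n ∈ J) ∧
      (g * j).coeff g.natDegree = t := by
    intro t ht
    induction ht using Submodule.mul_induction_on' with
    | mem_mul_mem m hm y hy =>
      rw [Polynomial.contentIdeal_def] at hm
      induction hm using Submodule.span_induction generalizing y with
      | mem c hc =>
        obtain ⟨n, hn, rfl⟩ := Polynomial.mem_coeffs_iff.1 (Finset.mem_coe.1 hc)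
        refine ⟨Polynomial.monomial (g.natDegree - n) y, fun k => ?_, ?_⟩
        · rw [Polynomial.coeff_monomial]
          split_ifs
          exacts [hy, J.zero_mem]
        · have hle := Polynomial.le_natDegree_of_mem_supp _ hn
          conv_lhs => rw [← Nat.add_sub_of_le hle]
          rw [Nat.add_sub_of_le hle, ← Polynomial.C_mul_X_pow_eq_monomial, ← mul_assoc,
            Polynomial.coeff_mul_X_pow', if_pos (Nat.sub_le _ _), Nat.sub_sub_self hle,
            Polynomial.coeff_mul_C]
      | zero => exact ⟨0, by simp, by simp⟩
      | add x x' _ _ h h' =>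
        obtain ⟨j, hj, e⟩ := h y hy
        obtain ⟨j', hj', e'⟩ := h' y hy
        exact ⟨j + j', fun n => by simpa using J.add_mem (hj n) (hj' n),
          by simp [mul_add, add_mul, e, e']⟩
      | smul a x _ h =>
        obtain ⟨j, hj, e⟩ := h (a * y) (J.mul_mem_left a hy)
        exact ⟨j, hj, by rw [e, smul_eq_mul]; ring⟩
    | add x _ x' _ h h' =>
      obtain ⟨j, hj, e⟩ := h
      obtain ⟨j', hj', e'⟩ := h'
      exact ⟨j + j', fun n => by simpa using J.add_mem (hj n) (hj' n), by simp [mul_add, e, e']⟩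
  obtain ⟨j, hj, e⟩ := key t ht
  refine ⟨j, ?_, _, e⟩
  rw [Polynomial.contentIdeal_def, Ideal.span_le]
  intro c hc
  obtain ⟨n, -, rfl⟩ := Polynomial.mem_coeffs_iff.1 (Finset.mem_coe.1 hc)
  exact hj n

/-- The content formula holds as soon as one of the contents is invertible. -/
theorem contentIdeal_mul_of_isUnit {S : Type u} [CommRing S] (f g : S[X])
    (hg : IsUnit (g.contentIdeal : FractionalIdeal S⁰ (FractionRing S))) :
    (f * g).contentIdeal = f.contentIdeal * g.contentIdeal := by
  refine le_antisymm (Polynomial.contentIdeal_mul_le_mul_contentIdeal f g) ?_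
  obtain ⟨J, t, ht, hJ⟩ := (isUnit_coeIdeal_iff _).1 hg
  obtain ⟨j, hj, n, hn⟩ := exists_coeff_mul_eq_of_mem_contentIdeal_mul g J
    (hJ ▸ Ideal.mem_span_singleton_self t)
  -- All coefficients of g j lie in c(g) J = (t), and one equals t. So g j = t h with 1 among the
  -- coefficients of h, and t c(f) ≤ c(f g j) ≤ c(f g) J. Multiplying by c(g) and cancelling t
  -- finishes.
  have hdvd : Polynomial.C t ∣ g * j := by
    rw [Polynomial.C_dvd_iff_dvd_coeff]
    intro k
    rw [← Ideal.mem_span_singleton, ← hJ]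
    exact (Polynomial.contentIdeal_mul_le_mul_contentIdeal g j).trans (Ideal.mul_mono_right hj)
      (Polynomial.coeff_mem_contentIdeal _ k)
  obtain ⟨h, hh⟩ := hdvd
  have hh1 : h.contentIdeal = ⊤ := by
    rw [Ideal.eq_top_iff_one]
    convert Polynomial.coeff_mem_contentIdeal h n
    rw [hh, Polynomial.coeff_C_mul] at hn
    exact ((mul_cancel_left_mem_nonZeroDivisors ht).1 (by rw [hn, mul_one])).symm
  have h1 : Ideal.span {t} * f.contentIdeal ≤ (f * g).contentIdeal * J := by
    calc Ideal.span {t} * f.contentIdeal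
        ≤ Ideal.span {t} * (f * h).contentIdeal :=
          Ideal.mul_mono_right (contentIdeal_le_contentIdeal_mul f h hh1)
      _ ≤ (f * g * j).contentIdeal := by
          rw [mul_assoc, hh, mul_left_comm f, Ideal.span_singleton_mul_le_iff]
          intro z hz
          rw [Polynomial.contentIdeal_def] at hz
          induction hz using Submodule.span_induction with
          | mem c hc =>
            obtain ⟨k, -, rfl⟩ := Polynomial.mem_coeffs_iff.1 (Finset.mem_coe.1 hc)
            rw [← Polynomial.coeff_C_mul]
            exact Polynomial.coeff_mem_contentIdeal _ k
          | zero => simp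
          | add x y _ _ hx hy => rw [mul_add]; exact Ideal.add_mem _ hx hy
          | smul a x _ hx => rw [smul_eq_mul, mul_left_comm t a]; exact Ideal.mul_mem_left _ _ hx
      _ ≤ _ := (Polynomial.contentIdeal_mul_le_mul_contentIdeal _ j).trans
          (Ideal.mul_mono_right hj)
  have h2 : Ideal.span {t} * (f.contentIdeal * g.contentIdeal) ≤
      Ideal.span {t} * (f * g).contentIdeal := by
    calc Ideal.span {t} * (f.contentIdeal * g.contentIdeal)
        = (Ideal.span {t} * f.contentIdeal) * g.contentIdeal := (mul_assoc _ _ _).symm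
      _ ≤ (f * g).contentIdeal * J * g.contentIdeal := Ideal.mul_mono_left h1
      _ = _ := by rw [mul_assoc, mul_comm J, hJ, mul_comm]
  intro z hz
  obtain ⟨w, hw, e⟩ := Ideal.mem_span_singleton_mul.1
    (h2 (Ideal.mul_mem_mul (Ideal.mem_span_singleton_self t) hz))
  rwa [← (mul_cancel_left_mem_nonZeroDivisors ht).1 e]

/-! ### Comaximal divisibility -/

/-- Any two elements divide each other up to comaximal factors. This is an elementwise form of
being arithmetical. -/
def ComaximalDvd (S : Type u) [CommRing S] : Prop :=
  ∀ a b : S, ∃ s : S, a ∣ s * b ∧ b ∣ (1 - s) * a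

theorem ComaximalDvd.of_surjective {S : Type u} {T : Type v} [CommRing S] [CommRing T]
    (h : ComaximalDvd S) (φ : S →+* T) (hφ : Function.Surjective φ) : ComaximalDvd T := by
  intro a b
  obtain ⟨a, rfl⟩ := hφ a
  obtain ⟨b, rfl⟩ := hφ b
  obtain ⟨s, h1, h2⟩ := h a b
  exact ⟨φ s, by simpa using map_dvd φ h1, by simpa using map_dvd φ h2⟩

/-- Over a ring with comaximal divisibility, a nonempty finite set of elements has a partition
of unity such that each element divides all the others up to its factor. -/
theorem ComaximalDvd.exists_partition {S : Type u} [CommRing S] (h : ComaximalDvd S)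
    (s : Finset S) (hs : s.Nonempty) :
    ∃ e : S → S, ∑ i ∈ s, e i = 1 ∧ ∀ i ∈ s, ∀ j ∈ s, i ∣ e i * j := by
  classical
  induction hs using Finset.Nonempty.cons_induction with
  | singleton a => exact ⟨fun _ => 1, by simp, by simp⟩
  | cons a s ha hs ih =>
    obtain ⟨e, he, hd⟩ := ih
    choose u hu1 hu2 using fun i => h i a
    have hne : ∀ i ∈ s, i ≠ a := fun i hi hia => ha (hia ▸ hi)
    -- Each old factor e k splits as e k * u k, kept by k, plus e k * (1 - u k), given to the new
    -- element a. The latter works since a divides (1 - u k) * k and k divides e k * j.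
    refine ⟨fun i => if i = a then ∑ k ∈ s, e k * (1 - u k) else e i * u i, ?_, ?_⟩
    · rw [Finset.sum_cons, if_pos rfl, Finset.sum_congr rfl (fun i hi => if_neg (hne i hi)),
        ← Finset.sum_add_distrib]
      exact (Finset.sum_congr rfl fun i _ => by ring).trans he
    · intro i hi j hj
      rw [Finset.mem_cons] at hi hj
      beta_reduce
      rcases hi with rfl | hi
      · rw [if_pos rfl, Finset.sum_mul]
        refine Finset.dvd_sum fun k hk => ?_
        rcases hj with rfl | hj
        · exact Dvd.intro_left _ rfl
        · have h1 : i ∣ (e k * j) * (1 - u k) := by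
            obtain ⟨c, hc⟩ := hd k hk j hj
            rw [hc, show k * c * (1 - u k) = (1 - u k) * k * c by ring]
            exact (hu2 k).mul_right c
          convert h1 using 1
          ring
      · rw [if_neg (hne i hi)]
        rcases hj with rfl | hj
        · rw [mul_assoc]
          exact (hu1 i).mul_left _
        · rw [mul_right_comm]
          exact (hd i hi j hj).mul_right _

/-- A domain is Prüfer iff it has comaximal divisibility. -/
theorem isPruferDomain_iff_comaximalDvd (A : Type u) [CommRing A] [IsDomain A] :
    IsPruferDomain A ↔ ComaximalDvd A := by
  classical
  constructor
  · intro h a b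
    by_cases h0 : Ideal.span {a, b} = ⊥
    · rw [Ideal.span_eq_bot] at h0
      obtain rfl : a = 0 := h0 a (by simp)
      obtain rfl : b = 0 := h0 b (by simp)
      exact ⟨0, by simp, by simp⟩
    obtain ⟨J, t, ht, hJ⟩ := (isUnit_coeIdeal_iff _).1
      (h (Ideal.span {a, b}) ⟨{a, b}, by simp⟩ h0)
    have ht0 : t ≠ 0 := nonZeroDivisors.ne_zero ht
    have htm : t ∈ Ideal.span {a, b} * J := hJ ▸ Ideal.mem_span_singleton_self t
    rw [Ideal.span_insert, Ideal.sup_mul, Submodule.mem_sup] at htm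
    obtain ⟨_, hy, _, hz, hyz⟩ := htm
    obtain ⟨j, hj, rfl⟩ := Ideal.mem_span_singleton_mul.1 hy
    obtain ⟨k, hk, rfl⟩ := Ideal.mem_span_singleton_mul.1 hz
    have hdvd : ∀ c ∈ ({a, b} : Set A), ∀ l ∈ J, ∃ x, c * l = t * x := fun c hc l hl =>
      Ideal.mem_span_singleton.1 (hJ ▸ Ideal.mul_mem_mul (Ideal.subset_span hc) hl)
    obtain ⟨x, hx⟩ := hdvd a (by simp) j hj
    obtain ⟨y, hy⟩ := hdvd b (by simp) j hj
    obtain ⟨z, hz⟩ := hdvd a (by simp) k hk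
    obtain ⟨w, hw⟩ := hdvd b (by simp) k hk
    have hxw : 1 - x = w := by
      apply mul_left_cancel₀ ht0
      linear_combination hx + hw - hyz
    refine ⟨x, ⟨y, mul_left_cancel₀ ht0 ?_⟩, ⟨z, mul_left_cancel₀ ht0 ?_⟩⟩
    · linear_combination a * hy - b * hx
    · rw [hxw]
      linear_combination b * hz - a * hw
  · rintro h I ⟨s, rfl⟩ hI
    have hspan : Ideal.span ((s.erase 0 : Finset A) : Set A) = Ideal.span (s : Set A) := by
      rw [Finset.coe_erase]
      exact Submodule.span_sdiff_singleton_zero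
    change Ideal.span (s : Set A) ≠ ⊥ at hI
    change IsUnit ((Ideal.span (s : Set A) : Ideal A) : FractionalIdeal A⁰ (FractionRing A))
    rw [← hspan] at hI ⊢
    set s' := s.erase 0
    have hs' : s'.Nonempty := by
      rw [Finset.nonempty_iff_ne_empty]
      rintro h
      exact hI (by simp [h])
    obtain ⟨e, he, hd⟩ := h.exists_partition s' hs'
    -- Up to the product of all generators, the inverse is generated by the e i / i.
    refine (isUnit_coeIdeal_iff _).2
      ⟨Ideal.span ((fun i => e i * ∏ k ∈ s'.erase i, k) '' s'), ∏ k ∈ s', k, ?_, ?_⟩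
    · rw [mem_nonZeroDivisors_iff_ne_zero, Finset.prod_ne_zero_iff]
      exact fun a ha => Finset.ne_of_mem_erase ha
    · apply le_antisymm
      · rw [Ideal.span_mul_span', Ideal.span_le]
        rintro _ ⟨j, hj, _, ⟨i, hi, rfl⟩, rfl⟩
        rw [SetLike.mem_coe, Ideal.mem_span_singleton]
        obtain ⟨c, hc⟩ := hd i hi j hj
        rw [← Finset.mul_prod_erase s' (fun k => k) hi]
        exact ⟨c, by linear_combination (∏ k ∈ s'.erase i, k) * hc⟩
      · rw [Ideal.span_singleton_le_iff_mem, ← one_mul (∏ k ∈ s', k), ← he, Finset.sum_mul]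
        refine Ideal.sum_mem _ fun i hi => ?_
        rw [← Finset.mul_prod_erase s' _ hi, mul_left_comm]
        exact Ideal.mul_mem_mul (Ideal.subset_span hi) (Ideal.subset_span ⟨i, hi, rfl⟩)

/-! ### Gaussian rings -/

/-- In a Gaussian ring `ab ∈ (a², b²)`. -/
theorem IsGaussianRing.mul_mem_span_sq {S : Type u} [CommRing S] (h : IsGaussianRing S)
    (a b : S) : a * b ∈ Ideal.span {a ^ 2, b ^ 2} := by
  have h1 := h (Polynomial.C a + Polynomial.C b * Polynomial.X)
    (Polynomial.C a - Polynomial.C b * Polynomial.X)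
  have h2 : a * b ∈ (Polynomial.C a + Polynomial.C b * Polynomial.X).contentIdeal *
      (Polynomial.C a - Polynomial.C b * Polynomial.X).contentIdeal := by
    rw [← neg_mem_iff, ← mul_neg]
    exact Ideal.mul_mem_mul (mem_contentIdeal_of_coeff_eq 0 (by simp))
      (mem_contentIdeal_of_coeff_eq 1 (by simp [Polynomial.coeff_C]))
  rw [← h1] at h2
  refine (?_ : Polynomial.contentIdeal _ ≤ _) h2
  rw [Polynomial.contentIdeal_def, Ideal.span_le]
  intro c hc
  obtain ⟨n, -, rfl⟩ := Polynomial.mem_coeffs_iff.1 (Finset.mem_coe.1 hc)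
  have e : (Polynomial.C a + Polynomial.C b * Polynomial.X) *
      (Polynomial.C a - Polynomial.C b * Polynomial.X) =
      Polynomial.C (a ^ 2) - Polynomial.C (b ^ 2) * Polynomial.X ^ 2 := by
    simp only [map_pow]
    ring
  rw [e, Polynomial.coeff_sub, Polynomial.coeff_C, Polynomial.coeff_C_mul, Polynomial.coeff_X_pow]
  refine Ideal.sub_mem _ ?_ (Ideal.mul_mem_right _ _ (Ideal.subset_span (by simp)))
  split_ifs
  exacts [Ideal.subset_span (by simp), Ideal.zero_mem _]

theorem IsGaussianRing.of_surjective {S : Type u} {T : Type v} [CommRing S] [CommRing T]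
    (h : IsGaussianRing S) (φ : S →+* T) (hφ : Function.Surjective φ) : IsGaussianRing T := by
  intro f g
  obtain ⟨f, rfl⟩ := Polynomial.map_surjective φ hφ f
  obtain ⟨g, rfl⟩ := Polynomial.map_surjective φ hφ g
  simp only [← Polynomial.map_mul, Polynomial.contentIdeal_map_eq_map_contentIdeal, h f g,
    Ideal.map_mul]

/-- A Gaussian domain has comaximal divisibility. -/
theorem IsGaussianRing.comaximalDvd {A : Type u} [CommRing A] [IsDomain A]
    (h : IsGaussianRing A) : ComaximalDvd A := by
  intro a b
  by_cases ha : a = 0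
  · exact ⟨0, by simp [ha], by simp [ha]⟩
  obtain ⟨c, d, hcd⟩ := Ideal.mem_span_pair.1 (h.mul_mem_span_sq a b)
  -- With ab = ca² + db², m/a and 1 - m/a are the roots of X² - X + cd. Integral closedness would
  -- give a ∣ m; here the content formula for the product of the two linear factors does.
  set m := d * b with hm
  have hdvd : a ∣ m := by
    have h1 := h (Polynomial.C a * Polynomial.X - Polynomial.C m)
      (Polynomial.C a * Polynomial.X - Polynomial.C (a - m))
    have e : (Polynomial.C a * Polynomial.X - Polynomial.C m) *
        (Polynomial.C a * Polynomial.X - Polynomial.C (a - m)) =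
        Polynomial.C (a ^ 2) *
          (Polynomial.X ^ 2 - Polynomial.X + Polynomial.C (c * d)) := by
      have hmm : Polynomial.C m * Polynomial.C (a - m) =
          Polynomial.C (a ^ 2) * Polynomial.C (c * d) := by
        rw [← Polynomial.C_mul, ← Polynomial.C_mul]
        congr 1
        rw [hm]
        linear_combination -d * hcd
      simp only [map_pow, map_sub] at hmm ⊢
      linear_combination hmm
    have h2 : m * a ∈ (Polynomial.C a * Polynomial.X - Polynomial.C m).contentIdeal *
        (Polynomial.C a * Polynomial.X - Polynomial.C (a - m)).contentIdeal := by
      rw [← neg_mem_iff, ← neg_mul]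
      exact Ideal.mul_mem_mul (mem_contentIdeal_of_coeff_eq 0 (by simp))
        (mem_contentIdeal_of_coeff_eq 1 (by simp [Polynomial.coeff_C, -map_sub]))
    rw [← h1, e] at h2
    have h3 := Polynomial.contentIdeal_mul_le_mul_contentIdeal _ _ h2
    rw [Polynomial.contentIdeal_C] at h3
    obtain ⟨w, -, hw⟩ := Ideal.mem_span_singleton_mul.1 h3
    exact ⟨w, mul_right_cancel₀ ha (by linear_combination -hw)⟩
  obtain ⟨m', hm'⟩ := hdvd
  refine ⟨1 - m', ⟨c, mul_left_cancel₀ ha ?_⟩, ⟨d, ?_⟩⟩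
  · linear_combination b * hm' - hcd - b * hm
  · linear_combination hm - hm'

/-! ### Arithmetical rings -/

/-- In a local ring with principal two-generated ideals divisibility is total. -/
theorem dvd_or_dvd_of_isPrincipal_span_pair {S : Type u} [CommRing S] [IsLocalRing S] {a b : S}
    (h : (Ideal.span {a, b}).IsPrincipal) : a ∣ b ∨ b ∣ a := by
  obtain ⟨c, hc⟩ := h.principal
  change Ideal.span {a, b} = Ideal.span {c} at hc
  obtain ⟨x, hx⟩ := Ideal.mem_span_singleton.1 (hc ▸ Ideal.subset_span (by simp) : a ∈ _)
  obtain ⟨y, hy⟩ := Ideal.mem_span_singleton.1 (hc ▸ Ideal.subset_span (by simp) : b ∈ _)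
  obtain ⟨z, w, hzw⟩ := Ideal.mem_span_pair.1 (hc ▸ Ideal.mem_span_singleton_self c :
    c ∈ Ideal.span {a, b})
  -- Either 1 - (z x + w y) is a unit and c = 0, or one of z x, w y is a unit, and then a or b
  -- generates the ideal.
  have e : c * (1 - (z * x + w * y)) = 0 := by rw [hx, hy] at hzw; linear_combination -hzw
  by_cases hu : IsUnit (1 - (z * x + w * y))
  · have hc0 : c = 0 := by rwa [hu.mul_left_eq_zero] at e
    left
    rw [hy, hc0, zero_mul]
    exact dvd_zero _
  · have h1 : IsUnit (z * x + w * y) :=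
      (IsLocalRing.isUnit_or_isUnit_of_add_one (by ring : (1 - (z * x + w * y)) +
        (z * x + w * y) = 1)).resolve_left hu
    rcases IsLocalRing.isUnit_or_isUnit_of_isUnit_add h1 with h2 | h2
    · left
      obtain ⟨i, hi⟩ := (isUnit_of_mul_isUnit_right h2).exists_right_inv
      exact ⟨i * y, by rw [hx, hy]; linear_combination -c * y * hi⟩
    · right
      obtain ⟨i, hi⟩ := (isUnit_of_mul_isUnit_right h2).exists_right_inv
      exact ⟨i * x, by rw [hx, hy]; linear_combination -c * x * hi⟩

/-- A ring is arithmetical iff it has comaximal divisibility. -/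
theorem isArithmeticalRing_iff_comaximalDvd (S : Type u) [CommRing S] :
    IsArithmeticalRing S ↔ ComaximalDvd S := by
  classical
  constructor
  · intro h a b
    -- The colon ideals (a : b) and (b : a). A maximal ideal P containing both would contradict
    -- total divisibility in the localization at P after clearing denominators.
    let I₁ : Ideal S := Submodule.comap (LinearMap.mulRight S b) (Ideal.span {a})
    let I₂ : Ideal S := Submodule.comap (LinearMap.mulRight S a) (Ideal.span {b})
    have htop : I₁ ⊔ I₂ = ⊤ := by
      by_contra hne
      obtain ⟨P, hP, hle⟩ := Ideal.exists_le_maximal _ hne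
      have hloc : ∀ x y : S, algebraMap S (Localization.AtPrime P) x ∣
          algebraMap S (Localization.AtPrime P) y → ∃ s ∉ P, s * y ∈ Ideal.span {x} := by
        rintro x y ⟨z, hz⟩
        obtain ⟨⟨r, s⟩, hrs⟩ := IsLocalization.surj P.primeCompl z
        have h1 : algebraMap S (Localization.AtPrime P) (s * y) =
            algebraMap S (Localization.AtPrime P) (x * r) := by
          rw [map_mul, map_mul, hz, ← hrs]
          ring
        obtain ⟨k, hk⟩ := (IsLocalization.eq_iff_exists P.primeCompl _).1 h1
        refine ⟨k * s, (k * s).2, Ideal.mem_span_singleton.2 ⟨k * r, ?_⟩⟩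
        linear_combination hk
      have hp := h (Ideal.span {a, b}) ⟨{a, b}, by simp⟩ P
      rw [Ideal.map_span, Set.image_pair] at hp
      rcases dvd_or_dvd_of_isPrincipal_span_pair hp with h1 | h1
      · obtain ⟨s, hs, hs'⟩ := hloc _ _ h1
        exact hs (hle (Ideal.mem_sup_left (show s ∈ I₁ from hs')))
      · obtain ⟨s, hs, hs'⟩ := hloc _ _ h1
        exact hs (hle (Ideal.mem_sup_right (show s ∈ I₂ from hs')))
    obtain ⟨s, hs, s', hs', e⟩ := Submodule.mem_sup.1 ((Ideal.eq_top_iff_one _).1 htop)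
    refine ⟨s, Ideal.mem_span_singleton.1 hs, ?_⟩
    rw [← e, add_sub_cancel_left]
    exact Ideal.mem_span_singleton.1 hs'
  · intro h I hI P hP
    have hbez : IsBezout (Localization.AtPrime P) := by
      rw [IsBezout.iff_span_pair_isPrincipal]
      intro x y
      obtain ⟨x, s, rfl⟩ := IsLocalization.exists_mk'_eq P.primeCompl x
      obtain ⟨y, t, rfl⟩ := IsLocalization.exists_mk'_eq P.primeCompl y
      obtain ⟨c, ⟨p, hp⟩, ⟨q, hq⟩⟩ := h x y
      have hdvd : ∀ (x y c p : S) (s t : P.primeCompl), c ∉ P → c * y = x * p →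
          IsLocalization.mk' (Localization.AtPrime P) x s ∣ IsLocalization.mk' _ y t := by
        intro x y c p s t hc e
        refine ⟨IsLocalization.mk' _ (p * s) (⟨c, hc⟩ * t : P.primeCompl), ?_⟩
        rw [← IsLocalization.mk'_mul, IsLocalization.mk'_eq_iff_eq]
        congr 1
        simp only [Submonoid.coe_mul]
        linear_combination (s.1 * t.1) * e
      by_cases hc : c ∈ P
      · have hc' : 1 - c ∉ P := fun h' =>
          hP.ne_top ((Ideal.eq_top_iff_one P).2 (by simpa using P.add_mem h' hc))
        have := hdvd _ _ _ _ t s hc' hq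
        rw [Ideal.span_pair_comm, (Ideal.span_pair_eq_span_left_iff_dvd).2 this]
        exact ⟨_, rfl⟩
      · have := hdvd _ _ _ _ s t hc hp
        rw [(Ideal.span_pair_eq_span_left_iff_dvd).2 this]
        exact ⟨_, rfl⟩
    exact hbez.isPrincipal_of_FG _ (hI.map _)

/-! ### The trivial extension -/

section

variable {A : Type u} {B : Type v} [CommRing A] [CommRing B] [Algebra A B] [Module Aᵐᵒᵖ B]
  [IsCentralScalar A B]

open TrivSqZeroExt

theorem snd_mul_eq (x y : TrivSqZeroExt A B) :
    (x * y).snd = algebraMap A B x.fst * y.snd + algebraMap A B y.fst * x.snd := by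
  rw [snd_mul, op_smul_eq_smul, Algebra.smul_def, Algebra.smul_def]

/-- The projection of the trivial extension to its base, as a ring homomorphism. -/
noncomputable def fstRingHom (A : Type u) (B : Type v) [CommRing A] [CommRing B] [Algebra A B]
    [Module Aᵐᵒᵖ B] [IsCentralScalar A B] : TrivSqZeroExt A B →+* A :=
  (fstHom A A B).toRingHom

theorem fstRingHom_apply (x : TrivSqZeroExt A B) : fstRingHom A B x = x.fst := rfl

theorem fstRingHom_surjective : Function.Surjective (fstRingHom A B) := fun a => ⟨inl a, rfl⟩

end

/-! ### The quotient field of A and clearing denominators -/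

section

variable {A : Type u} {B : Type v} [CommRing A] [IsDomain A] [CommRing B] [IsDomain B]
  [Algebra A B]

theorem quotientFieldIn_le_iff (hAB : Function.Injective (algebraMap A B)) :
    quotientFieldIn hAB ≤ domainInQuotientField B ↔
      ∀ a : A, a ≠ 0 → ∃ d : B, algebraMap A B a * d = 1 := by
  have hinj := IsFractionRing.injective B (FractionRing B)
  have hmap : ∀ a : A, IsFractionRing.map (K := FractionRing A) (L := FractionRing B) hAB
      (algebraMap A (FractionRing A) a) = algebraMap B (FractionRing B) (algebraMap A B a) :=
    fun a => IsLocalization.map_eq _ a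
  constructor
  · intro h a ha
    obtain ⟨d, hd⟩ := h (⟨(algebraMap A (FractionRing A) a)⁻¹, rfl⟩ : _ ∈ quotientFieldIn hAB)
    refine ⟨d, hinj ?_⟩
    have ha' : algebraMap B (FractionRing B) (algebraMap A B a) ≠ 0 := by
      rwa [Ne, map_eq_zero_iff _ hinj, map_eq_zero_iff _ hAB]
    rw [map_mul, hd, map_inv₀, hmap, mul_inv_cancel₀ ha', map_one]
  · rintro h _ ⟨k, rfl⟩
    obtain ⟨a, s, hs, rfl⟩ := IsFractionRing.div_surjective (A := A) k
    obtain ⟨d, hd⟩ := h s (nonZeroDivisors.ne_zero hs)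
    refine ⟨algebraMap A B a * d, ?_⟩
    have hs' : algebraMap B (FractionRing B) (algebraMap A B s) ≠ 0 := by
      rw [Ne, map_eq_zero_iff _ hinj, map_eq_zero_iff _ hAB]
      exact nonZeroDivisors.ne_zero hs
    rw [map_div₀, hmap, hmap, eq_div_iff hs', ← map_mul]
    congr 1
    linear_combination algebraMap A B a * hd

theorem domainInQuotientField_le_iff (hAB : Function.Injective (algebraMap A B)) :
    domainInQuotientField B ≤ quotientFieldIn hAB ↔
      ∀ b : B, ∃ a c : A, a ≠ 0 ∧ algebraMap A B a * b = algebraMap A B c := by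
  have hinj := IsFractionRing.injective B (FractionRing B)
  have hmap : ∀ a : A, IsFractionRing.map (K := FractionRing A) (L := FractionRing B) hAB
      (algebraMap A (FractionRing A) a) = algebraMap B (FractionRing B) (algebraMap A B a) :=
    fun a => IsLocalization.map_eq _ a
  have hne : ∀ s : A, s ≠ 0 → algebraMap B (FractionRing B) (algebraMap A B s) ≠ 0 := by
    intro s hs
    rwa [Ne, map_eq_zero_iff _ hinj, map_eq_zero_iff _ hAB]
  constructor
  · intro h b
    obtain ⟨k, hk⟩ := h (⟨b, rfl⟩ : _ ∈ domainInQuotientField B)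
    obtain ⟨a, s, hs, rfl⟩ := IsFractionRing.div_surjective (A := A) k
    have hs0 := nonZeroDivisors.ne_zero hs
    refine ⟨s, a, hs0, hinj ?_⟩
    rw [map_div₀, hmap, hmap, div_eq_iff (hne s hs0)] at hk
    rw [map_mul, hk, mul_comm]
  · rintro h _ ⟨b, rfl⟩
    obtain ⟨a, c, ha, e⟩ := h b
    refine ⟨algebraMap A _ c / algebraMap A _ a, ?_⟩
    rw [map_div₀, hmap, hmap, div_eq_iff (hne a ha), ← e, map_mul, mul_comm]

/-- For a finite family in `B`, some nonzero `c` and a family in `A` satisfy all the `A`-linear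
relations expressing elements of `A` through the given family: they are the values, after clearing
denominators, of a linear functional at `1` and at the family. -/
theorem exists_compatible_values (hAB : Function.Injective (algebraMap A B)) {ι : Type}
    [Fintype ι] (b : ι → B) :
    ∃ (c : A) (p : ι → A), c ≠ 0 ∧ ∀ (r : A) (s : ι → A),
      algebraMap A B r = ∑ j, algebraMap A B (s j) * b j → c * r = ∑ j, s j * p j := by
  let _ : Algebra (FractionRing A) (FractionRing B) :=
    (IsFractionRing.map (K := FractionRing A) (L := FractionRing B) hAB).toAlgebra
  have hmap : ∀ a : A, algebraMap (FractionRing A) (FractionRing B)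
      (algebraMap A (FractionRing A) a) = algebraMap B (FractionRing B) (algebraMap A B a) :=
    fun a => IsLocalization.map_eq
      (nonZeroDivisors_le_comap_nonZeroDivisors_of_injective (algebraMap A B) hAB) a
  -- A K-linear retraction of Frac B onto K; it fixes A, and c is a common denominator of its values
  -- at the family.
  obtain ⟨ψ, hψ⟩ := LinearMap.exists_leftInverse_of_injective
    (Algebra.linearMap (FractionRing A) (FractionRing B))
    (LinearMap.ker_eq_bot.2 (algebraMap (FractionRing A) (FractionRing B)).injective)
  obtain ⟨c, hc⟩ := IsLocalization.exist_integer_multiples_of_finite A⁰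
    (fun j => ψ (algebraMap B (FractionRing B) (b j)))
  choose p hp using hc
  refine ⟨c, p, nonZeroDivisors.coe_ne_zero c, fun r s hrs => ?_⟩
  apply IsFractionRing.injective A (FractionRing A)
  have h1 := congrArg (fun z => ψ (algebraMap B (FractionRing B) z)) hrs
  simp only [map_sum, map_mul, ← hmap] at h1
  have h2 : ∀ k, ψ (algebraMap (FractionRing A) (FractionRing B) k) = k :=
    fun k => LinearMap.congr_fun hψ k
  simp only [h2, ← Algebra.smul_def, map_smul] at h1
  rw [map_mul, h1, map_sum, Finset.mul_sum]
  refine Finset.sum_congr rfl fun j _ => ?_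
  rw [map_mul, hp j, smul_eq_mul, Algebra.smul_def]
  ring

end

section

variable {A : Type u} {B : Type v} [CommRing A] [CommRing B] [Algebra A B] [Module Aᵐᵒᵖ B]
  [IsCentralScalar A B]

open TrivSqZeroExt

/-- N is killed by (0, 1), and B is torsion-free over A. -/
theorem mem_nonZeroDivisors_iff_fst_ne_zero [IsDomain A] [IsDomain B]
    (hAB : Function.Injective (algebraMap A B))
    {x : TrivSqZeroExt A B} : x ∈ (TrivSqZeroExt A B)⁰ ↔ x.fst ≠ 0 := by
  constructor
  · intro hx h0
    have h1 : inr (1 : B) * x = 0 := by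
      ext
      · simp
      · simp [h0]
    have h2 := congrArg snd ((mem_nonZeroDivisors_iff_right.1 hx) _ h1)
    simp at h2
  · intro hx
    rw [mem_nonZeroDivisors_iff_right]
    intro y hy
    have h1 := congrArg fst hy
    have h2 := congrArg snd hy
    have hy1 : y.fst = 0 := by simpa [hx] using h1
    have hx' : algebraMap A B x.fst ≠ 0 := (map_ne_zero_iff _ hAB).2 hx
    rw [snd_mul_eq] at h2
    ext
    · exact hy1
    · simpa [hy1, hx'] using h2

/-! ### Gaussian and Prüfer trivial extensions -/

/-- For x = (a, 0), y = (0, 1) and I = (x, y), y² = 0 gives I² = I x. Cancelling the invertible I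
leaves I = (x), so x divides y. -/
theorem exists_inv_of_isPruferRing [IsDomain A] [IsDomain B]
    (hAB : Function.Injective (algebraMap A B))
    (h : IsPruferRing (TrivSqZeroExt A B)) (a : A) (ha : a ≠ 0) :
    ∃ d : B, algebraMap A B a * d = 1 := by
  classical
  set x : TrivSqZeroExt A B := inl a with hx
  set y : TrivSqZeroExt A B := inr 1 with hy
  have hxm : x ∈ Ideal.span {x, y} := Ideal.subset_span (by simp)
  have hu := h (Ideal.span {x, y}) ⟨{x, y}, by simp⟩
    ⟨x, hxm, (mem_nonZeroDivisors_iff_fst_ne_zero hAB).2 (by simpa [hx] using ha)⟩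
  have hyy : y * y = 0 := inr_mul_inr _ _ _
  have h1 : Ideal.span {x, y} * Ideal.span {x, y} = Ideal.span {x, y} * Ideal.span {x} := by
    apply le_antisymm
    · rw [Ideal.span_pair_mul_span_pair, Ideal.span_le]
      rintro _ (rfl | rfl | rfl | rfl)
      · exact Ideal.mul_mem_mul hxm (Ideal.mem_span_singleton_self x)
      · rw [mul_comm x y]
        exact Ideal.mul_mem_mul (Ideal.subset_span (by simp)) (Ideal.mem_span_singleton_self x)
      · exact Ideal.mul_mem_mul (Ideal.subset_span (by simp)) (Ideal.mem_span_singleton_self x)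
      · rw [hyy]
        exact Ideal.zero_mem _
    · exact Ideal.mul_mono_right (Ideal.span_mono (by simp))
  have h2 : Ideal.span {x, y} = Ideal.span {x} := by
    apply FractionalIdeal.coeIdeal_injective' (P := FractionRing (TrivSqZeroExt A B)) le_rfl
    apply hu.mul_left_cancel
    rw [← FractionalIdeal.coeIdeal_mul, ← FractionalIdeal.coeIdeal_mul, h1]
  obtain ⟨z, hz⟩ := Ideal.mem_span_singleton.1 (h2 ▸ Ideal.subset_span (by simp) : y ∈ _)
  have := congrArg snd hz
  rw [snd_mul_eq] at this
  exact ⟨z.snd, by simpa [hx, hy] using this.symm⟩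

theorem isPruferDomain_of_isPruferRing [IsDomain A] [IsDomain B]
    (hAB : Function.Injective (algebraMap A B))
    (h : IsPruferRing (TrivSqZeroExt A B)) : IsPruferDomain A := by
  intro I hI hI0
  obtain ⟨a, haI, ha⟩ := Submodule.exists_mem_ne_zero_of_ne_bot hI0
  obtain ⟨J, t, ht, hJ⟩ := (isUnit_coeIdeal_iff _).1 (h (I.map (inlHom A B)) (hI.map _)
    ⟨inl a, Ideal.mem_map_of_mem (inlHom A B) haI,
      (mem_nonZeroDivisors_iff_fst_ne_zero hAB).2 (by simpa using ha)⟩)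
  refine (isUnit_coeIdeal_iff _).2 ⟨J.map (fstRingHom A B), t.fst,
    mem_nonZeroDivisors_iff_ne_zero.2 ((mem_nonZeroDivisors_iff_fst_ne_zero hAB).1 ht), ?_⟩
  have h1 := congrArg (Ideal.map (fstRingHom A B)) hJ
  rwa [Ideal.map_mul, Ideal.map_map, Ideal.map_span, Set.image_singleton,
    show (fstRingHom A B).comp (inlHom A B) = RingHom.id A from rfl, Ideal.map_id] at h1

/-- Since (0, 1)² = 0, the product (a, 0)(0, 1) is a multiple of (a, 0)², so a = a² d in B. -/
theorem exists_inv_of_isGaussianRing [IsDomain B] (hAB : Function.Injective (algebraMap A B))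
    (h : IsGaussianRing (TrivSqZeroExt A B)) (a : A) (ha : a ≠ 0) :
    ∃ d : B, algebraMap A B a * d = 1 := by
  have h1 := h.mul_mem_span_sq (inl a) (inr 1)
  obtain ⟨c, d, hcd⟩ := Ideal.mem_span_pair.1 h1
  have := congrArg snd hcd
  have ha' : algebraMap A B a ≠ 0 := (map_ne_zero_iff _ hAB).2 ha
  refine ⟨c.snd, mul_left_cancel₀ ha' ?_⟩
  rw [pow_two, pow_two, inl_mul_inl, inr_mul_inr, mul_zero, add_zero, snd_mul_eq, snd_mul_eq,
    fst_inl, snd_inl, fst_inl, snd_inl, snd_inr, fst_inr, map_mul] at this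
  linear_combination this

/-- If the nonzero elements of `A` are invertible in `B`, an element with nonzero first
component divides every element whose first component is a multiple of its own. -/
theorem dvd_of_fst_dvd (hinv : ∀ a : A, a ≠ 0 → ∃ d : B, algebraMap A B a * d = 1)
    {x y : TrivSqZeroExt A B} (hx : x.fst ≠ 0) (h : x.fst ∣ y.fst) : x ∣ y := by
  obtain ⟨c, hc⟩ := h
  obtain ⟨d, hd⟩ := hinv _ hx
  -- The second component solves x₁ v + c x₂ = y₂ for v, with d the inverse of x₁.
  refine ⟨inl c + inr (d * (y.snd - algebraMap A B c * x.snd)), ?_⟩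
  ext
  · simpa using hc
  · rw [snd_mul_eq]
    simp only [snd_add, snd_inl, snd_inr, fst_add, fst_inl, fst_inr, zero_add, add_zero]
    linear_combination -(y.snd - algebraMap A B c * x.snd) * hd

/-- A regular ideal contains N, so it is the extension of its image in A, whose inverse extends as
well. -/
theorem isPruferRing_of_isPruferDomain [IsDomain A] [IsDomain B]
    (hAB : Function.Injective (algebraMap A B))
    (hA : IsPruferDomain A) (hinv : ∀ a : A, a ≠ 0 → ∃ d : B, algebraMap A B a * d = 1) :
    IsPruferRing (TrivSqZeroExt A B) := by
  rintro I hI ⟨r, hrI, hr⟩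
  rw [mem_nonZeroDivisors_iff_fst_ne_zero hAB] at hr
  have hcontains : ∀ (I : Ideal (TrivSqZeroExt A B)), (∃ r ∈ I, r.fst ≠ 0) →
      ∀ y : TrivSqZeroExt A B, y.fst = 0 → y ∈ I := by
    rintro I ⟨r, hrI, hr⟩ y hy
    exact Ideal.mem_of_dvd _ (dvd_of_fst_dvd hinv hr (by simp [hy])) hrI
  set I₀ := I.map (fstRingHom A B) with hI₀
  have hrI₀ : r.fst ∈ I₀ := Ideal.mem_map_of_mem (fstRingHom A B) hrI
  have hmapI : I₀.map (inlHom A B) = I := by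
    apply le_antisymm
    · rw [Ideal.map_le_iff_le_comap]
      intro a ha
      obtain ⟨z, hz, rfl⟩ :=
        (Ideal.mem_map_iff_of_surjective (fstRingHom A B) fstRingHom_surjective).1 ha
      have : inlHom A B (fstRingHom A B z) - z ∈ I :=
        hcontains I ⟨r, hrI, hr⟩ _ (by simp [fstRingHom_apply, inlHom])
      rw [Ideal.mem_comap]
      simpa using I.add_mem this hz
    · intro z hz
      have h1 : inlHom A B z.fst ∈ I₀.map (inlHom A B) :=
        Ideal.mem_map_of_mem _ (Ideal.mem_map_of_mem (fstRingHom A B) hz)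
      have h2 : z - inlHom A B z.fst ∈ I₀.map (inlHom A B) :=
        hcontains _ ⟨inlHom A B r.fst, Ideal.mem_map_of_mem _ hrI₀, by simpa [inlHom] using hr⟩
          _ (by simp [inlHom])
      simpa using Ideal.add_mem _ h2 h1
  obtain ⟨J, t, ht, hJ⟩ := (isUnit_coeIdeal_iff _).1 (hA I₀ (hI.map _)
    (fun h0 => hr (by simpa [h0] using hrI₀)))
  refine (isUnit_coeIdeal_iff _).2 ⟨J.map (inlHom A B), inlHom A B t,
    (mem_nonZeroDivisors_iff_fst_ne_zero hAB).2 (nonZeroDivisors.ne_zero ht), ?_⟩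
  rw [← hmapI, ← Ideal.map_mul, hJ, Ideal.map_span, Set.image_singleton]

theorem isGaussianRing_of_isPruferRing [IsDomain A] [IsDomain B]
    (hAB : Function.Injective (algebraMap A B))
    (h : IsPruferRing (TrivSqZeroExt A B)) : IsGaussianRing (TrivSqZeroExt A B) := by
  have key : ∀ f g : (TrivSqZeroExt A B)[X], (∃ n, (g.coeff n).fst ≠ 0) →
      (f * g).contentIdeal = f.contentIdeal * g.contentIdeal := by
    rintro f g ⟨n, hn⟩
    exact contentIdeal_mul_of_isUnit f g (h _ g.contentIdeal_FG
      ⟨_, g.coeff_mem_contentIdeal n, (mem_nonZeroDivisors_iff_fst_ne_zero hAB).2 hn⟩)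
  intro f g
  by_cases hg : ∃ n, (g.coeff n).fst ≠ 0
  · exact key f g hg
  by_cases hf : ∃ n, (f.coeff n).fst ≠ 0
  · rw [mul_comm f g, mul_comm f.contentIdeal]
    exact key g f hf
  push Not at hf hg
  refine le_antisymm (Polynomial.contentIdeal_mul_le_mul_contentIdeal f g) ?_
  rw [Polynomial.contentIdeal_def, Polynomial.contentIdeal_def, Ideal.span_mul_span', Ideal.span_le]
  rintro _ ⟨x, hx, y, hy, rfl⟩
  obtain ⟨n, -, rfl⟩ := Polynomial.mem_coeffs_iff.1 (Finset.mem_coe.1 hx)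
  obtain ⟨m, -, rfl⟩ := Polynomial.mem_coeffs_iff.1 (Finset.mem_coe.1 hy)
  have : f.coeff n * g.coeff m = 0 := by
    ext
    · simp [hf n]
    · simp [hf n, hg m]
  simp [this]

/-! ### Arithmetical trivial extensions -/

/-- As (0, 1) divides (1 - s)(a, 0), the first component of s is 1; then (a, 0) ∣ s (0, 1) inverts
a. -/
theorem exists_inv_of_comaximalDvd [IsDomain A]
    (h : ComaximalDvd (TrivSqZeroExt A B)) (a : A) (ha : a ≠ 0) :
    ∃ d : B, algebraMap A B a * d = 1 := by
  obtain ⟨s, ⟨c, hc⟩, ⟨d, hd⟩⟩ := h (inl a) (inr 1)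
  have h1 := congrArg snd hc
  have h2 := congrArg fst hd
  have h3 : s.fst = 1 := by
    have : (1 - s.fst) * a = 0 := by simpa using h2
    rcases mul_eq_zero.1 this with h | h
    · exact (sub_eq_zero.1 h).symm
    · exact absurd h ha
  refine ⟨c.snd, ?_⟩
  simpa [h3, Algebra.smul_def] using h1.symm

/-- Comparing (0, 1) with (0, b) yields s₁ b ∈ A and 1 - s₁ ∈ A b, where s₁ is the first component
of s. So b is a fraction if s₁ ≠ 0, and the inverse of an element of A otherwise. -/
theorem exists_fraction_of_comaximalDvd [IsDomain B]
    (h : ComaximalDvd (TrivSqZeroExt A B)) (b : B) :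
    ∃ a c : A, a ≠ 0 ∧ algebraMap A B a * b = algebraMap A B c := by
  obtain ⟨s, ⟨c, hc⟩, ⟨d, hd⟩⟩ := h (inr 1) (inr b)
  have h1 : algebraMap A B s.fst * b = algebraMap A B c.fst := by
    simpa [Algebra.smul_def] using congrArg snd hc
  have h2 : algebraMap A B (1 - s.fst) = algebraMap A B d.fst * b := by
    simpa [Algebra.smul_def] using congrArg snd hd
  by_cases hs : s.fst = 0
  · rw [hs, sub_zero] at h2
    refine ⟨d.fst, 1, ?_, h2.symm⟩
    intro h0
    simp [h0] at h2
  · exact ⟨_, _, hs, h1⟩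

/-- A regular element divides N, and two regular elements compare as in A. Two elements of N are
fractions c/a and c'/a', compared through their numerators a'c and ac' over a common denominator. -/
theorem comaximalDvd_trivSqZeroExt [IsDomain A] [IsDomain B]
    (hAB : Function.Injective (algebraMap A B))
    (hA : ComaximalDvd A) (hinv : ∀ a : A, a ≠ 0 → ∃ d : B, algebraMap A B a * d = 1)
    (hfrac : ∀ b : B, ∃ a c : A, a ≠ 0 ∧ algebraMap A B a * b = algebraMap A B c) :
    ComaximalDvd (TrivSqZeroExt A B) := by
  intro x y
  by_cases hx : x.fst = 0
  · by_cases hy : y.fst = 0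
    · obtain ⟨a, c, ha, hac⟩ := hfrac x.snd
      obtain ⟨a', c', ha', hac'⟩ := hfrac y.snd
      obtain ⟨s, ⟨p, hp⟩, ⟨q, hq⟩⟩ := hA (a' * c) (a * c')
      have h0 : algebraMap A B a * algebraMap A B a' ≠ 0 :=
        mul_ne_zero ((map_ne_zero_iff _ hAB).2 ha) ((map_ne_zero_iff _ hAB).2 ha')
      have hp' := congrArg (algebraMap A B) hp
      have hq' := congrArg (algebraMap A B) hq
      simp only [map_mul, map_sub, map_one] at hp' hq'
      refine ⟨inl s, ⟨inl p, ?_⟩, ⟨inl q, ?_⟩⟩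
      · ext
        · simp [hx, hy]
        · simp only [snd_mul_eq, fst_inl, snd_inl, mul_zero, zero_add, add_zero]
          apply mul_left_cancel₀ h0
          linear_combination hp' + algebraMap A B s * algebraMap A B a * hac' -
            algebraMap A B a' * algebraMap A B p * hac
      · ext
        · simp [hx, hy]
        · simp only [snd_mul_eq, fst_inl, snd_inl, mul_zero, zero_add, add_zero, fst_sub, snd_sub,
            fst_one, snd_one, map_sub, map_one, sub_zero]
          apply mul_left_cancel₀ h0
          linear_combination hq' + (1 - algebraMap A B s) * algebraMap A B a' * hac -
            algebraMap A B a * algebraMap A B q * hac'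
    · exact ⟨0, by simp, by simpa using dvd_of_fst_dvd hinv hy (by simp [hx])⟩
  · by_cases hy : y.fst = 0
    · exact ⟨1, by simpa using dvd_of_fst_dvd hinv hx (by simp [hy]), by simp⟩
    · obtain ⟨s, h1, h2⟩ := hA x.fst y.fst
      exact ⟨inl s, dvd_of_fst_dvd hinv hx (by simpa using h1),
        dvd_of_fst_dvd hinv hy (by simpa using h2)⟩

/-! ### The weak dimension -/

/-! ### The weak dimension -/

/-- A weak form of the vanishing of `Tor₁` against the base ring: every element killed by `(0, 1)`
lies in `N M` up to a nonzero factor from `A`, where `N` is the kernel of the projection to `A`. -/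
def TorVanishes (A : Type u) (B : Type v) [CommRing A] [CommRing B] [Algebra A B]
    [Module Aᵐᵒᵖ B] [IsCentralScalar A B] (M : Type*) [AddCommGroup M]
    [Module (TrivSqZeroExt A B) M] : Prop :=
  ∀ m : M, (inr 1 : TrivSqZeroExt A B) • m = 0 → ∃ a : A, a ≠ 0 ∧
    (inl a : TrivSqZeroExt A B) • m ∈
      (RingHom.ker (fstRingHom A B) • ⊤ : Submodule (TrivSqZeroExt A B) M)

theorem torVanishes_of_flat [IsDomain A] [IsDomain B]
    (hAB : Function.Injective (algebraMap A B)) (M : Type*)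
    [AddCommGroup M] [Module (TrivSqZeroExt A B) M] [Module.Flat (TrivSqZeroExt A B) M] :
    TorVanishes A B M := by
  intro m hm
  obtain ⟨k, a, y, h1, h2⟩ := Module.Flat.isTrivialRelation_of_sum_smul_eq_zero
    (ι := Unit) (f := fun _ => (inr 1 : TrivSqZeroExt A B)) (x := fun _ => m) (by simpa using hm)
  refine ⟨1, one_ne_zero, ?_⟩
  rw [inl_one, one_smul, show m = _ from h1 ()]
  refine Submodule.sum_mem _ fun j _ => Submodule.smul_mem_smul ?_ trivial
  have h3 := congrArg snd (h2 j)
  rw [Finset.univ_unique, Finset.sum_singleton, snd_mul_eq] at h3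
  rw [RingHom.mem_ker, fstRingHom_apply]
  apply hAB
  simpa using h3

theorem exists_sum_of_mem_ker_smul_top {M : Type*} [AddCommGroup M]
    [Module (TrivSqZeroExt A B) M] {z : M}
    (hz : z ∈ (RingHom.ker (fstRingHom A B) • ⊤ : Submodule (TrivSqZeroExt A B) M)) :
    ∃ (ι : Type) (_ : Fintype ι) (b : ι → B) (l : ι → M),
      z = ∑ j, (inr (b j) : TrivSqZeroExt A B) • l j := by
  induction hz using Submodule.smul_induction_on' with
  | smul r hr n _ =>
    refine ⟨Unit, inferInstance, fun _ => r.snd, fun _ => n, ?_⟩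
    have : r = inr r.snd := by
      ext
      · exact hr
      · simp
    rw [Finset.univ_unique, Finset.sum_singleton, ← this]
  | add x _ y _ hx hy =>
    obtain ⟨ι, _, b, l, rfl⟩ := hx
    obtain ⟨κ, _, b', l', rfl⟩ := hy
    exact ⟨ι ⊕ κ, inferInstance, Sum.elim b b', Sum.elim l l', by simp⟩

/-- Lift m to y in F. Then (0, 1) y lies in the kernel and is killed by (0, 1), so a (0, 1) y = Σ
(0, bᵢ) lᵢ with lᵢ in the kernel. Flatness of F trivializes this relation, and the linear functional
of `exists_compatible_values` replaces the bᵢ by elements of A. -/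
theorem torVanishes_of_torVanishes_ker [IsDomain A] [IsDomain B]
    (hAB : Function.Injective (algebraMap A B))
    {F M : Type*} [AddCommGroup F] [Module (TrivSqZeroExt A B) F] [AddCommGroup M]
    [Module (TrivSqZeroExt A B) M] [Module.Flat (TrivSqZeroExt A B) F]
    (f : F →ₗ[TrivSqZeroExt A B] M) (hf : Function.Surjective f)
    (h : TorVanishes A B (LinearMap.ker f)) : TorVanishes A B M := by
  intro m hm
  obtain ⟨y, rfl⟩ := hf m
  obtain ⟨a, ha, hal⟩ := h ⟨(inr 1 : TrivSqZeroExt A B) • y, by simpa using hm⟩ (by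
    ext
    simp [← mul_smul])
  obtain ⟨ι, _, b, l, e⟩ := exists_sum_of_mem_ker_smul_top hal
  have e' : (inl a : TrivSqZeroExt A B) • (inr 1 : TrivSqZeroExt A B) • y =
      ∑ j, (inr (b j) : TrivSqZeroExt A B) • (l j : F) := by
    simpa using congrArg Subtype.val e
  obtain ⟨k, r, z, h1, h2⟩ := Module.Flat.isTrivialRelation_of_sum_smul_eq_zero
    (ι := Option ι)
    (f := fun o => o.elim (-(inl a * inr 1) : TrivSqZeroExt A B) fun j => inr (b j))
    (x := fun o => o.elim y fun j => (l j : F)) (by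
      rw [Fintype.sum_option]
      simp only [Option.elim]
      rw [← e', neg_smul, mul_smul, neg_add_cancel])
  obtain ⟨c, p, hc, hp⟩ := exists_compatible_values hAB b
  have hk : ∀ j, c * (a * (r none j).fst) = ∑ i, (r (some i) j).fst * p i := by
    intro j
    apply hp
    have h3 := congrArg snd (h2 j)
    rw [Fintype.sum_option, snd_add, snd_sum] at h3
    simp only [Option.elim, snd_mul_eq, fst_inr, snd_inr, map_zero, zero_mul, zero_add, fst_neg,
      snd_neg, fst_mul, fst_inl, snd_inl, mul_zero, mul_one, neg_zero, add_zero, snd_zero] at h3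
    rw [map_mul]
    linear_combination -h3
  refine ⟨c * a, mul_ne_zero hc ha, ?_⟩
  -- This is the image under f of c a y - Σ pᵢ lᵢ, where f kills the lᵢ; by `hk` its coefficients
  -- lie in N.
  have key : (inl (c * a) : TrivSqZeroExt A B) • f y =
      ∑ j, (inl (c * a) * r none j - ∑ i, inl (p i) * r (some i) j) • f (z j) := by
    have hy : f y = ∑ j, r none j • f (z j) := by
      have := congrArg f (h1 none)
      simpa using this
    have hl : ∀ i, ∑ j, r (some i) j • f (z j) = 0 := by
      intro i
      have := congrArg f (h1 (some i))
      simpa [(l i).2] using this.symm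
    simp only [sub_smul, Finset.sum_sub_distrib, Finset.sum_smul, mul_smul]
    rw [Finset.sum_comm (s := Finset.univ (α := Fin k)) (t := Finset.univ (α := ι))]
    simp only [← Finset.smul_sum, hl, smul_zero, Finset.sum_const_zero, sub_zero]
    rw [hy]
  rw [key]
  refine Submodule.sum_mem _ fun j _ => Submodule.smul_mem_smul ?_ trivial
  rw [RingHom.mem_ker, fstRingHom_apply, fst_sub, fst_mul, fst_inl, fst_sum, mul_assoc, hk j,
    sub_eq_zero]
  refine Finset.sum_congr rfl fun i _ => ?_
  rw [fst_mul, fst_inl, mul_comm]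

theorem torVanishes_of_hasFlatDimLE [IsDomain A] [IsDomain B]
    (hAB : Function.Injective (algebraMap A B)) (n : ℕ)
    (M : Type (max u v)) [AddCommGroup M] [Module (TrivSqZeroExt A B) M]
    (h : HasFlatDimLE (TrivSqZeroExt A B) n M) : TorVanishes A B M := by
  induction n generalizing M with
  | zero =>
    have : Module.Flat (TrivSqZeroExt A B) M := h
    exact torVanishes_of_flat hAB M
  | succ n ih =>
    obtain ⟨F, _, _, f, hF, hf, hk⟩ := h
    exact torVanishes_of_torVanishes_ker hAB f hf (ih _ hk)

theorem not_torVanishes_quotient :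
    ¬ TorVanishes A B (TrivSqZeroExt A B ⧸ RingHom.ker (fstRingHom A B)) := by
  intro h
  obtain ⟨a, ha, hm⟩ := h (Ideal.Quotient.mk _ 1) (by
    rw [← Ideal.Quotient.mk_eq_mk, ← Submodule.Quotient.mk_smul, Submodule.Quotient.mk_eq_zero,
      smul_eq_mul, mul_one, RingHom.mem_ker, fstRingHom_apply, fst_inr])
  have hle : (RingHom.ker (fstRingHom A B) • ⊤ : Submodule (TrivSqZeroExt A B)
      (TrivSqZeroExt A B ⧸ RingHom.ker (fstRingHom A B))) ≤ ⊥ := by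
    rw [Submodule.smul_le]
    intro r hr n _
    obtain ⟨n, rfl⟩ := Submodule.Quotient.mk_surjective _ n
    rw [Submodule.mem_bot, ← Submodule.Quotient.mk_smul, Submodule.Quotient.mk_eq_zero]
    exact Ideal.mul_mem_right _ _ hr
  have h0 := hle hm
  rw [Submodule.mem_bot, ← Ideal.Quotient.mk_eq_mk, ← Submodule.Quotient.mk_smul,
    Submodule.Quotient.mk_eq_zero, smul_eq_mul, mul_one, RingHom.mem_ker, fstRingHom_apply,
    fst_inl] at h0
  exact ha h0

theorem weakDim_trivSqZeroExt [IsDomain A] [IsDomain B]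
    (hAB : Function.Injective (algebraMap A B)) :
    weakDim (TrivSqZeroExt A B) = ⊤ := by
  have h1 : flatDim (TrivSqZeroExt A B)
      (TrivSqZeroExt A B ⧸ RingHom.ker (fstRingHom A B)) = ⊤ := by
    rw [flatDim, iInf₂_eq_top]
    exact fun n hn => absurd (torVanishes_of_hasFlatDimLE hAB n _ hn) not_torVanishes_quotient
  rw [← top_le_iff, ← h1]
  exact le_iSup (fun M : ModuleCat.{max u v} (TrivSqZeroExt A B) => flatDim (TrivSqZeroExt A B) M)
    (ModuleCat.of _ (TrivSqZeroExt A B ⧸ RingHom.ker (fstRingHom A B)))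

end

/- `TrivSqZeroExt A B` is the trivial ring extension of `A` by the `A`-module `B`. Mathlib defines
it for bimodules; `IsCentralScalar A B` says that the right action of `A` is the left one. -/
theorem theorem2p1 {A : Type u} {B : Type v} [CommRing A] [IsDomain A] [CommRing B] [IsDomain B]
    [Algebra A B] (hAB : Function.Injective (algebraMap A B))
    [Module Aᵐᵒᵖ B] [IsCentralScalar A B] :
    ((IsGaussianRing (TrivSqZeroExt A B) ↔ IsPruferRing (TrivSqZeroExt A B)) ∧
      (IsPruferRing (TrivSqZeroExt A B) ↔
        IsPruferDomain A ∧ quotientFieldIn hAB ≤ domainInQuotientField B)) ∧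
    (IsArithmeticalRing (TrivSqZeroExt A B) ↔
      IsPruferDomain A ∧ quotientFieldIn hAB = domainInQuotientField B) ∧
    weakDim (TrivSqZeroExt A B) = ⊤ := by
  refine ⟨⟨⟨fun h => ?_, isGaussianRing_of_isPruferRing hAB⟩, ?_⟩, ?_, weakDim_trivSqZeroExt hAB⟩
  · exact isPruferRing_of_isPruferDomain hAB ((isPruferDomain_iff_comaximalDvd A).2
      (h.of_surjective (fstRingHom A B) fstRingHom_surjective).comaximalDvd)
      (exists_inv_of_isGaussianRing hAB h)
  · rw [quotientFieldIn_le_iff]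
    exact ⟨fun h => ⟨isPruferDomain_of_isPruferRing hAB h, exists_inv_of_isPruferRing hAB h⟩,
      fun h => isPruferRing_of_isPruferDomain hAB h.1 h.2⟩
  · rw [isArithmeticalRing_iff_comaximalDvd, isPruferDomain_iff_comaximalDvd, le_antisymm_iff,
      quotientFieldIn_le_iff, domainInQuotientField_le_iff]
    exact ⟨fun h => ⟨h.of_surjective (fstRingHom A B) fstRingHom_surjective,
      exists_inv_of_comaximalDvd h, exists_fraction_of_comaximalDvd h⟩,
      fun h => comaximalDvd_trivSqZeroExt hAB h.1 h.2.1 h.2.2⟩
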